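/- Let $Q$ be a midpoint diagonal quadrilateral in the Euclidean plane, that is, a (nondegenerate) convex quadrilateral whose diagonals intersect at the midpoint of at least one of them (parallelograms are included). An ellipse (circles are included) is inscribed in $Q$ if it lies inside $Q$ and is tangent to each side of $Q$; its eccentricity is $\sqrt{1-b^2/a^2}$, where $a\ge b>0$ are the lengths of its semi-major and semi-minor axes. (i) There is a unique ellipse $E_I$ of minimal eccentricity among all ellipses inscribed in $Q$. (ii) Call two diameters of an ellipse (chords through its center) equal conjugate diameters if they have the same length and each of them bisects all chords parallel to the other. Then $E_I$ has a pair of equal conjugate diameters, and for every such pair the smallest non-negative angle between the two diameters (the angle in $[0,\pi/2]$ between the lines that contain them) equals the smallest non-negative angle between the diagonals of $Q$. -/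

import Mathlib

namespace MidpointDiagonal

/-- The Euclidean plane. -/
abbrev Plane : Type := EuclideanSpace ℝ (Fin 2)

/-- `A`, `B`, `C`, `D` are, in cyclic order, the vertices of a (nondegenerate) convex
quadrilateral: no three of them are collinear and the diagonals `AC` and `BD` meet. -/
structure IsConvexQuadrilateral (A B C D : Plane) : Prop where
  not_collinear_ABC : ¬ Collinear ℝ {A, B, C}
  not_collinear_BCD : ¬ Collinear ℝ {B, C, D}
  not_collinear_CDA : ¬ Collinear ℝ {C, D, A}
  not_collinear_DAB : ¬ Collinear ℝ {D, A, B}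
  diagonals_meet : (segment ℝ A C ∩ segment ℝ B D).Nonempty

/-- A midpoint diagonal quadrilateral: a convex quadrilateral whose diagonals meet at the midpoint
of at least one of them. -/
def IsMidpointDiagonal (A B C D : Plane) : Prop :=
  IsConvexQuadrilateral A B C D ∧
    ∃ P ∈ segment ℝ A C ∩ segment ℝ B D, P = midpoint ℝ A C ∨ P = midpoint ℝ B D

/-- `E` is the ellipse (as a curve) with center `c`, semi-major axis of length `a` in the
direction of the unit vector `u`, and semi-minor axis of length `b` in the direction of the unit
vector `v` orthogonal to `u`. Circles (`a = b`) are included. -/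
structure IsEllipseWith (E : Set Plane) (c u v : Plane) (a b : ℝ) : Prop where
  norm_u : ‖u‖ = 1
  norm_v : ‖v‖ = 1
  inner_uv : inner ℝ u v = 0
  b_pos : 0 < b
  b_le_a : b ≤ a
  eq_setOf : E = {X | (inner ℝ u (X - c) / a) ^ 2 + (inner ℝ v (X - c) / b) ^ 2 = 1}

/-- `E` is an ellipse. -/
def IsEllipse (E : Set Plane) : Prop :=
  ∃ c u v : Plane, ∃ a b : ℝ, IsEllipseWith E c u v a b

/-- `c` is the center of the ellipse `E`. -/
def IsCenterOf (E : Set Plane) (c : Plane) : Prop :=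
  ∃ u v : Plane, ∃ a b : ℝ, IsEllipseWith E c u v a b

/-- `E` is an ellipse of eccentricity `e`, that is, `e = √(1 - b² / a²)` where `a` and `b` are the
lengths of the semi-major and semi-minor axes of `E`. -/
def HasEccentricity (E : Set Plane) (e : ℝ) : Prop :=
  ∃ c u v : Plane, ∃ a b : ℝ, IsEllipseWith E c u v a b ∧ e = √(1 - b ^ 2 / a ^ 2)

/-- The side `PQ` is tangent to the ellipse `E`: the line through `P` and `Q` has exactly one
point in common with `E`, and this point lies on the side. -/
def IsTangentToSide (E : Set Plane) (P Q : Plane) : Prop :=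
  ∃ T ∈ segment ℝ P Q, (line[ℝ, P, Q] : Set Plane) ∩ E = {T}

/-- `E` is an ellipse inscribed in the quadrilateral `ABCD`: it lies inside the quadrilateral and
is tangent to each of its four sides. -/
structure IsInscribed (E : Set Plane) (A B C D : Plane) : Prop where
  isEllipse : IsEllipse E
  subset : E ⊆ convexHull ℝ {A, B, C, D}
  tangent_AB : IsTangentToSide E A B
  tangent_BC : IsTangentToSide E B C
  tangent_CD : IsTangentToSide E C D
  tangent_DA : IsTangentToSide E D A

/-- `E` is an ellipse of minimal eccentricity among all ellipses inscribed in `ABCD`. -/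
def IsMinEccentricityInscribed (E : Set Plane) (A B C D : Plane) : Prop :=
  IsInscribed E A B C D ∧
    ∃ e, HasEccentricity E e ∧
      ∀ (E' : Set Plane) (e' : ℝ), IsInscribed E' A B C D → HasEccentricity E' e' → e ≤ e'

/-- The segment `PP'` is a diameter of the ellipse `E`: a chord bisected by the center of `E`. -/
def IsDiameter (E : Set Plane) (P P' : Plane) : Prop :=
  P ∈ E ∧ P' ∈ E ∧ IsCenterOf E (midpoint ℝ P P')

/-- The segment `PP'` bisects every chord of `E` that is parallel to `RR'`. -/
def BisectsChordsParallelTo (E : Set Plane) (P P' R R' : Plane) : Prop :=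
  ∀ X ∈ E, ∀ Y ∈ E, X ≠ Y → (∃ t : ℝ, Y - X = t • (R' - R)) → midpoint ℝ X Y ∈ segment ℝ P P'

/-- `PP'` and `RR'` are conjugate diameters of the ellipse `E`, each bisecting the chords parallel
to the other, and they have equal length. -/
structure AreEqualConjugateDiameters (E : Set Plane) (P P' R R' : Plane) : Prop where
  diameter_left : IsDiameter E P P'
  diameter_right : IsDiameter E R R'
  bisects_left : BisectsChordsParallelTo E P P' R R'
  bisects_right : BisectsChordsParallelTo E R R' P P'
  equal : dist P P' = dist R R'

/-- The smallest non-negative angle between the lines `PP'` and `RR'` (for `P ≠ P'`, `R ≠ R'`);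
it lies in `[0, π / 2]`. -/
noncomputable def smallestAngle (P P' R R' : Plane) : ℝ :=
  min (InnerProductGeometry.angle (P' - P) (R' - R))
    (Real.pi - InnerProductGeometry.angle (P' - P) (R' - R))

end MidpointDiagonal

namespace MidpointDiagonal

/-! Take the intersection `P` of the diagonals as origin, with `P` the midpoint of `AC`, and use the
oblique basis `p`, `q` along the diagonals, scaled so that `‖p‖ = ‖q‖`. The vertices become `P ± p`,
`P + β • q`, `P - δ • q`. Write an ellipse as the image of the unit circle under `c + s • w + t •
z`. Its support function depends only on `c` and on the quadratic form of `w`, `z`, so tangency to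
the four sides gives four equations. By the symmetry of `A` and `C` about `P` they force the center
onto line `BD` and make that form diagonal, with entries `m`, `n` (`inscribed_constraints`).

Then `a² + b² = (m + n)‖p‖²` and `a²b² = m n · Gram(p, q)` (`axes_eq_of_diagonal`). Eccentricity
decreases as `a²b² / (a² + b²)²` grows, hence as `mn / (m + n)²` does, so by AM-GM it is minimal
exactly when `m = n`. The remaining equations determine a single ellipse with `m = n`, and that
ellipse is indeed inscribed.

With `m = n = r²`, the vectors `r • p` and `r • q` are conjugate radii of equal length along the
diagonals. Any other pair of equal conjugate diameters forces `p ⟂ q`; the ellipse is then a circle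
and both angles are right (`smallestAngle_equalConjugate`). -/

/-! ### Parametrized ellipses and their support functions -/

/-- The image of the unit circle under `(s, t) ↦ c + s • w + t • z`. -/
def ellipseOf (c w z : Plane) : Set Plane :=
  {X | ∃ s t : ℝ, s ^ 2 + t ^ 2 = 1 ∧ X = c + s • w + t • z}

/-- `ξ` and `η` are the coordinate functionals of the basis `p`, `q`. -/
structure IsFrame (p q : Plane) (ξ η : Plane →ₗ[ℝ] ℝ) : Prop where
  ξp : ξ p = 1
  ξq : ξ q = 0
  ηp : η p = 0
  ηq : η q = 1
  repr : ∀ X, ξ X • p + η X • q = X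

lemma exists_isFrame {p q : Plane} (h : LinearIndependent ℝ ![p, q]) :
    ∃ ξ η, IsFrame p q ξ η := by
  let b := basisOfLinearIndependentOfCardEqFinrank h (by simp)
  have h0 : b 0 = p := by simp [b]
  have h1 : b 1 = q := by simp [b]
  refine ⟨b.coord 0, b.coord 1, ?_, ?_, ?_, ?_, fun X => ?_⟩
  · rw [← h0]; simp
  · rw [← h1]; simp
  · rw [← h0]; simp
  · rw [← h1]; simp
  · have := b.sum_repr X
    rw [Fin.sum_univ_two, h0, h1] at this
    simpa using this

lemma inner_comb (p q : Plane) (x y x' y' : ℝ) :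
    inner ℝ (x • p + y • q) (x' • p + y' • q) =
      x * x' * ‖p‖ ^ 2 + (x * y' + y * x') * inner ℝ p q + y * y' * ‖q‖ ^ 2 := by
  simp only [inner_add_left, inner_add_right, real_inner_smul_left, real_inner_smul_right,
    real_inner_self_eq_norm_sq, real_inner_comm p q]
  ring

lemma norm_sq_comb (p q : Plane) (x y : ℝ) :
    ‖x • p + y • q‖ ^ 2 = x ^ 2 * ‖p‖ ^ 2 + 2 * (x * y) * inner ℝ p q + y ^ 2 * ‖q‖ ^ 2 := by
  rw [← real_inner_self_eq_norm_sq, inner_comb]; ring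

lemma setOf_eq_ellipseOf {c u v : Plane} {a b : ℝ} (hu : ‖u‖ = 1) (hv : ‖v‖ = 1)
    (huv : inner ℝ u v = 0) (ha : a ≠ 0) (hb : b ≠ 0) :
    {X : Plane | (inner ℝ u (X - c) / a) ^ 2 + (inner ℝ v (X - c) / b) ^ 2 = 1} =
      ellipseOf c (a • u) (b • v) := by
  have hli : LinearIndependent ℝ ![u, v] := by
    rw [LinearIndependent.pair_iff]
    intro s t h
    have h1 := congrArg (inner ℝ u) h
    have h2 := congrArg (inner ℝ v) h
    rw [inner_add_right, real_inner_smul_right, real_inner_smul_right] at h1 h2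
    have huv' := huv
    rw [real_inner_comm] at huv'
    constructor
    · simpa [hu, huv] using h1
    · simpa [hv, huv'] using h2
  obtain ⟨ξ, η, hf⟩ := exists_isFrame hli
  have key : ∀ x y : ℝ, inner ℝ u (x • u + y • v) = x ∧ inner ℝ v (x • u + y • v) = y := by
    intro x y
    have huv' := huv
    rw [real_inner_comm] at huv'
    simp [inner_add_right, real_inner_smul_right, hu, hv, huv, huv']
  ext X
  constructor
  · intro h
    refine ⟨_, _, h, ?_⟩
    have hX := hf.repr (X - c)
    have h1 := key (ξ (X - c)) (η (X - c))
    rw [hX] at h1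
    rw [smul_smul, smul_smul, div_mul_cancel₀ _ ha, div_mul_cancel₀ _ hb, h1.1, h1.2, add_assoc,
      hX]
    abel
  · rintro ⟨s, t, h, rfl⟩
    have h1 := key (s * a) (t * b)
    have h2 : c + s • a • u + t • b • v - c = (s * a) • u + (t * b) • v := by
      rw [smul_smul, smul_smul]; abel
    simp only [Set.mem_ofPred_eq, h2, h1.1, h1.2]
    rw [mul_div_cancel_right₀ _ ha, mul_div_cancel_right₀ _ hb, h]

lemma IsEllipseWith.eq_ellipseOf {E : Set Plane} {c u v : Plane} {a b : ℝ}
    (h : IsEllipseWith E c u v a b) : E = ellipseOf c (a • u) (b • v) := by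
  rw [h.eq_setOf]
  exact setOf_eq_ellipseOf h.norm_u h.norm_v h.inner_uv (h.b_pos.trans_le h.b_le_a).ne' h.b_pos.ne'

lemma ellipseOf_swap (c w z : Plane) : ellipseOf c w z = ellipseOf c z w := by
  ext X
  constructor <;>
  · rintro ⟨s, t, h, rfl⟩
    exact ⟨t, s, by linarith, by abel⟩

lemma isEllipse_of_orthogonal {c w z : Plane} (hw : w ≠ 0) (hz : z ≠ 0) (h : inner ℝ w z = 0) :
    IsEllipse (ellipseOf c w z) := by
  wlog hle : ‖z‖ ≤ ‖w‖ generalizing w z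
  · rw [ellipseOf_swap]
    exact this hz hw (by rwa [real_inner_comm]) (le_of_not_ge hle)
  have hw' : ‖w‖ ≠ 0 := norm_ne_zero_iff.2 hw
  have hz' : ‖z‖ ≠ 0 := norm_ne_zero_iff.2 hz
  have h1 : ‖‖w‖⁻¹ • w‖ = 1 := by simp [norm_smul, hw']
  have h2 : ‖‖z‖⁻¹ • z‖ = 1 := by simp [norm_smul, hz']
  have h3 : inner ℝ (‖w‖⁻¹ • w) (‖z‖⁻¹ • z) = 0 := by
    rw [real_inner_smul_left, real_inner_smul_right, h]; simp
  refine ⟨c, _, _, _, _, h1, h2, h3, norm_pos_iff.2 hz, hle, ?_⟩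
  rw [setOf_eq_ellipseOf h1 h2 h3 hw' hz', smul_inv_smul₀ hw', smul_inv_smul₀ hz']

/-- Reparametrization of an ellipse by an orthogonal change of conjugate radii. -/
lemma ellipseOf_congr {c p q : Plane} {w₁ w₂ z₁ z₂ r : ℝ} (hr : r ≠ 0)
    (h₁ : w₁ ^ 2 + z₁ ^ 2 = r ^ 2) (h₂ : w₂ ^ 2 + z₂ ^ 2 = r ^ 2) (h₁₂ : w₁ * w₂ + z₁ * z₂ = 0) :
    ellipseOf c (w₁ • p + w₂ • q) (z₁ • p + z₂ • q) = ellipseOf c (r • p) (r • q) := by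
  have hr2 : r ^ 2 ≠ 0 := pow_ne_zero 2 hr
  -- The coefficient matrix is `r` times an orthogonal one: from its squared determinant,
  -- orthogonality of one pair (rows or columns) passes to the other.
  have hd : (w₁ * z₂ - w₂ * z₁) ^ 2 = r ^ 2 * r ^ 2 := by
    linear_combination (w₂ ^ 2 + z₂ ^ 2) * h₁ + r ^ 2 * h₂ - (w₁ * w₂ + z₁ * z₂) * h₁₂
  have e1 : r ^ 2 * (w₁ ^ 2 + w₂ ^ 2) = r ^ 2 * r ^ 2 := by
    linear_combination hd - w₁ ^ 2 * h₂ - w₂ ^ 2 * h₁ + 2 * w₁ * w₂ * h₁₂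
  have e2 : r ^ 2 * (z₁ ^ 2 + z₂ ^ 2) = r ^ 2 * r ^ 2 := by
    linear_combination r ^ 2 * h₁ + r ^ 2 * h₂ - e1
  have e1' := mul_left_cancel₀ hr2 e1
  have e2' := mul_left_cancel₀ hr2 e2
  have e3 : w₁ * z₁ + w₂ * z₂ = 0 := by
    have : r ^ 2 * (w₁ * z₁ + w₂ * z₂) = 0 := by
      linear_combination (-w₁ * z₁) * h₂ - w₂ * z₂ * h₁ + (w₁ * z₂ + w₂ * z₁) * h₁₂
    exact (mul_eq_zero.1 this).resolve_left hr2
  ext X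
  constructor
  · rintro ⟨s, t, h, rfl⟩
    refine ⟨(s * w₁ + t * z₁) / r, (s * w₂ + t * z₂) / r, ?_, ?_⟩
    · field_simp
      linear_combination s ^ 2 * e1' + t ^ 2 * e2' + 2 * s * t * e3 + r ^ 2 * h
    · rw [smul_smul, smul_smul, div_mul_cancel₀ _ hr, div_mul_cancel₀ _ hr]
      module
  · rintro ⟨x, y, h, rfl⟩
    refine ⟨(x * w₁ + y * w₂) / r, (x * z₁ + y * z₂) / r, ?_, ?_⟩
    · field_simp
      linear_combination x ^ 2 * h₁ + y ^ 2 * h₂ + 2 * x * y * h₁₂ + r ^ 2 * h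
    · have a1 : r * x = (x * w₁ + y * w₂) / r * w₁ + (x * z₁ + y * z₂) / r * z₁ := by
        field_simp
        linear_combination (-x) * h₁ - y * h₁₂
      have a2 : r * y = (x * w₁ + y * w₂) / r * w₂ + (x * z₁ + y * z₂) / r * z₂ := by
        field_simp
        linear_combination (-y) * h₂ - x * h₁₂
      have : x • r • p + y • r • q = (r * x) • p + (r * y) • q := by module
      rw [add_assoc, this, a1, a2]
      module

/-- The support function of an ellipse. -/
lemma isGreatest_image_ellipseOf (f : Plane →ₗ[ℝ] ℝ) (c w z : Plane) :
    IsGreatest (f '' ellipseOf c w z) (f c + √(f w ^ 2 + f z ^ 2)) := by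
  have hS : 0 ≤ f w ^ 2 + f z ^ 2 := by positivity
  constructor
  · rcases hS.eq_or_lt with h0 | hpos
    · have hw : f w = 0 := by nlinarith [sq_nonneg (f w), sq_nonneg (f z)]
      have hz : f z = 0 := by nlinarith [sq_nonneg (f w), sq_nonneg (f z)]
      exact ⟨c + (1 : ℝ) • w + (0 : ℝ) • z, ⟨1, 0, by norm_num, rfl⟩, by simp [hw, hz]⟩
    · have hσ := Real.sqrt_pos.2 hpos
      have hσ2 := Real.sq_sqrt hS
      set σ := √(f w ^ 2 + f z ^ 2)
      refine ⟨c + (f w / σ) • w + (f z / σ) • z, ⟨_, _, ?_, rfl⟩, ?_⟩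
      · field_simp; exact hσ2.symm
      · simp only [map_add, map_smul, smul_eq_mul]
        field_simp
        linear_combination -hσ2
  · rintro _ ⟨_, ⟨s, t, h, rfl⟩, rfl⟩
    simp only [map_add, map_smul, smul_eq_mul]
    have : s * f w + t * f z ≤ √(f w ^ 2 + f z ^ 2) := by
      apply Real.le_sqrt_of_sq_le
      nlinarith [sq_nonneg (s * f z - t * f w)]
    linarith

/-- The maxima of `f` and `-f` on the curve are `± f c` plus the same square root; their difference
and sum recover the two quantities. -/
lemma ellipseOf_inj_center {c w z c' w' z' : Plane} (h : ellipseOf c w z = ellipseOf c' w' z')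
    (f : Plane →ₗ[ℝ] ℝ) : f c = f c' ∧ f w ^ 2 + f z ^ 2 = f w' ^ 2 + f z' ^ 2 := by
  have h1 := (isGreatest_image_ellipseOf f c w z).unique
    (h ▸ isGreatest_image_ellipseOf f c' w' z')
  have h2 := (isGreatest_image_ellipseOf (-f) c w z).unique
    (h ▸ isGreatest_image_ellipseOf (-f) c' w' z')
  simp only [LinearMap.neg_apply, neg_sq] at h2
  refine ⟨by linarith, ?_⟩
  rw [← Real.sqrt_inj (by positivity) (by positivity)]
  linarith

lemma IsTangentToSide.symm {E : Set Plane} {U V : Plane} (h : IsTangentToSide E U V) :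
    IsTangentToSide E V U := by
  obtain ⟨T, hT, h⟩ := h
  exact ⟨T, segment_symm ℝ U V ▸ hT, by rwa [Set.pair_comm V U]⟩

/-! ### Quadrilaterals in oblique coordinates -/

/-- The quadrilateral with vertices `P ± p`, `P + β • q` and `P - δ • q`. -/
structure IsObliqueQuad (P p q : Plane) (β δ : ℝ) (A B C D : Plane) : Prop where
  eqA : A = P + (-1 : ℝ) • p
  eqB : B = P + β • q
  eqC : C = P + (1 : ℝ) • p
  eqD : D = P + (-δ) • q
  β_pos : 0 < β
  δ_pos : 0 < δ
  norm_eq : ‖p‖ = ‖q‖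
  linearIndependent : LinearIndependent ℝ ![p, q]

/-- In the coordinates of `p`, `q` the ellipse is a circle of radius `r` and the side has normal
`(ετ, 1)`, of signed length `b`. Tangency is the equality case of Cauchy-Schwarz, with parameter
point `(ετ, 1) / b`; `h₀` and `h₁` place the point of contact on the side. -/
lemma isTangentToSide_ellipseOf {P p q : Plane} {ξ η : Plane →ₗ[ℝ] ℝ} (hf : IsFrame p q ξ η)
    {ε τ k r b : ℝ} (hε : ε ^ 2 = 1) (hr : r ≠ 0) (hb : b ^ 2 = τ ^ 2 + 1)
    (hk : τ - k = r * b) (h₀ : 0 ≤ r * τ / b) (h₁ : r * τ / b ≤ 1) :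
    IsTangentToSide (ellipseOf (P + k • q) (r • p) (r • q)) (P + ε • p) (P + τ • q) := by
  have hb0 : b ≠ 0 := by
    rintro rfl
    nlinarith [sq_nonneg τ]
  have hT : P + k • q + (ε * τ / b) • r • p + (1 / b) • r • q =
      AffineMap.lineMap (P + τ • q) (P + ε • p) (r * τ / b) := by
    rw [AffineMap.lineMap_apply_module]
    have e1 : ε * τ / b * r = r * τ / b * ε := by ring
    have e2 : k + 1 / b * r = (1 - r * τ / b) * τ := by
      field_simp
      linear_combination (-b) * hk - r * hb
    have : P + k • q + (ε * τ / b) • r • p + (1 / b) • r • q =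
      P + (ε * τ / b * r) • p + (k + 1 / b * r) • q := by module
    rw [this, e1, e2]
    module
  have hmem : P + k • q + (ε * τ / b) • r • p + (1 / b) • r • q ∈
      segment ℝ (P + ε • p) (P + τ • q) := by
    rw [segment_symm, segment_eq_image_lineMap, hT]
    exact ⟨_, ⟨h₀, h₁⟩, rfl⟩
  refine ⟨_, hmem, ?_⟩
  ext X
  simp only [Set.mem_inter_iff, Set.mem_singleton_iff, SetLike.mem_coe]
  constructor
  · rintro ⟨hX, s, t, hst, rfl⟩
    obtain ⟨l, hl⟩ := mem_affineSpan_pair_iff_exists_lineMap_eq.1 hX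
    rw [AffineMap.lineMap_apply_module] at hl
    have g1 := congrArg ξ hl
    have g2 := congrArg η hl
    simp only [map_add, map_smul, smul_eq_mul, hf.ξp, hf.ξq, hf.ηp, hf.ηq] at g1 g2
    have g : r * (ε * τ * s + t) = r * b := by
      linear_combination hk - ε * τ * g1 + (1 - l) * τ * hε - g2
    have g' := mul_left_cancel₀ hr g
    -- Lagrange's identity: this square is the Cauchy-Schwarz defect of `(s, t)` and `(ετ, 1)`.
    have hs0 : (s - t * (ε * τ)) ^ 2 = 0 := by
      linear_combination (1 + ε ^ 2 * τ ^ 2) * hst - hb + τ ^ 2 * hε -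
        (ε * τ * s + t + b) * g'
    have hs := pow_eq_zero_iff (two_ne_zero) |>.1 hs0
    have ht : t = 1 / b := by
      rw [eq_div_iff hb0]
      have : b * (t * b - 1) = 0 := by
        linear_combination t * hb - ε * τ * hs - t * τ ^ 2 * hε + g'
      linarith [(mul_eq_zero.1 this).resolve_left hb0]
    have hs' : s = ε * τ / b := by
      rw [ht] at hs
      field_simp at hs ⊢
      linarith
    rw [hs', ht]
  · rintro rfl
    refine ⟨?_, _, _, ?_, rfl⟩
    · rw [hT, Set.pair_comm]
      exact AffineMap.lineMap_mem_affineSpan_pair _ _ _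
    · field_simp
      linear_combination τ ^ 2 * hε - hb

lemma mem_convexHull_of_abs_le {P p q : Plane} {β δ x y : ℝ} {A B C D : Plane}
    (hQ : IsObliqueQuad P p q β δ A B C D)
    (hβ : |x| * β + y ≤ β) (hδ : |x| * δ - y ≤ δ) :
    P + x • p + y • q ∈ convexHull ℝ {A, B, C, D} := by
  have aux : ∀ τ : ℝ, τ ≠ 0 → P + τ • q ∈ ({A, B, C, D} : Set Plane) → 0 ≤ y / τ →
      |x| + y / τ ≤ 1 → P + x • p + y • q ∈ convexHull ℝ {A, B, C, D} := by
    intro τ hτ hmem h0 h1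
    have hA : A ∈ convexHull ℝ {A, B, C, D} := subset_convexHull ℝ _ (by simp)
    have hC : C ∈ convexHull ℝ {A, B, C, D} := subset_convexHull ℝ _ (by simp)
    have hT := subset_convexHull ℝ _ hmem
    have hx := abs_le.1 (le_refl |x|)
    -- Barycentric coordinates in the triangle `A`, `C`, `P + τ • q`; the sign of `y` decides below
    -- which of `B`, `D` is the apex.
    have := Convex.sum_mem (convex_convexHull ℝ ({A, B, C, D} : Set Plane)) (t := Finset.univ)
      (w := ![(1 - y / τ - x) / 2, (1 - y / τ + x) / 2, y / τ])
      (z := ![A, C, P + τ • q])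
      (by intro i _; fin_cases i <;> simp <;> linarith [hx.1, hx.2])
      (by simp [Fin.sum_univ_three]; ring)
      (by intro i _; fin_cases i <;> simpa)
    convert this using 1
    simp only [Fin.sum_univ_three, Matrix.cons_val_zero, Matrix.cons_val_one, Matrix.cons_val,
      hQ.eqA, hQ.eqC]
    have e : y • q = (y / τ * τ) • q := by rw [div_mul_cancel₀ _ hτ]
    rw [e]
    module
  have hβ0 := hQ.β_pos
  have hδ0 := hQ.δ_pos
  rcases le_total 0 y with hy | hy
  · refine aux β hβ0.ne' (by simp [hQ.eqB]) (by positivity) ?_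
    rw [← le_sub_iff_add_le', div_le_iff₀ hβ0]; linarith
  · refine aux (-δ) (neg_ne_zero.2 hδ0.ne') (by simp [hQ.eqD]) ?_ ?_
    · rw [div_neg, ← neg_div]; exact div_nonneg (by linarith) hδ0.le
    · rw [div_neg, ← neg_div, ← le_sub_iff_add_le', div_le_iff₀ hδ0]; linarith

/-! ### The candidate ellipse -/

/-- The factor by which `p` and `q` are scaled to the equal conjugate radii of `minEllipse`. -/
noncomputable def minRadius (β δ : ℝ) : ℝ := (β + δ) / (√(β ^ 2 + 1) + √(δ ^ 2 + 1))

/-- The coordinate along `q` of the center of `minEllipse`. -/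
noncomputable def minCenter (β δ : ℝ) : ℝ := β - minRadius β δ * √(β ^ 2 + 1)

/-- The inscribed ellipse of minimal eccentricity. -/
noncomputable def minEllipse (P p q : Plane) (β δ : ℝ) : Set Plane :=
  ellipseOf (P + minCenter β δ • q) (minRadius β δ • p) (minRadius β δ • q)

lemma le_sqrt_sq_add_one (x : ℝ) : x ≤ √(x ^ 2 + 1) := Real.le_sqrt_of_sq_le (by linarith)

lemma minRadius_pos {β δ : ℝ} (hβ : 0 < β) (hδ : 0 < δ) : 0 < minRadius β δ := by
  unfold minRadius; positivity

lemma minRadius_mul (β δ : ℝ) :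
    minRadius β δ * (√(β ^ 2 + 1) + √(δ ^ 2 + 1)) = β + δ := by
  unfold minRadius
  have : 0 < √(β ^ 2 + 1) + √(δ ^ 2 + 1) := by positivity
  field_simp

lemma minRadius_comm (β δ : ℝ) : minRadius β δ = minRadius δ β := by
  unfold minRadius; ring

lemma minRadius_mul_div_le {β δ : ℝ} (hβ : 0 < β) (hδ : 0 < δ) :
    minRadius β δ * β / √(β ^ 2 + 1) ≤ 1 := by
  have h1 := le_sqrt_sq_add_one β
  have h2 := le_sqrt_sq_add_one δ
  have h3 : √(β ^ 2 + 1) ^ 2 = β ^ 2 + 1 := Real.sq_sqrt (by positivity)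
  have h4 : 0 < √(β ^ 2 + 1) := by positivity
  have h5 : 0 < √(δ ^ 2 + 1) := by positivity
  unfold minRadius
  rw [div_le_one h4, div_mul_eq_mul_div, div_le_iff₀ (by positivity)]
  nlinarith [mul_le_mul h1 h2 hδ.le h4.le]

lemma isEllipse_of_norm_eq {c p q : Plane} {r : ℝ} (hr : r ≠ 0) (hpq : ‖p‖ = ‖q‖)
    (hli : LinearIndependent ℝ ![p, q]) : IsEllipse (ellipseOf c (r • p) (r • q)) := by
  have h2 : (√2 : ℝ) ≠ 0 := by positivity
  have hs : (√2 : ℝ) ^ 2 = 2 := Real.sq_sqrt (by norm_num)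
  have hx : r / √2 ≠ 0 := div_ne_zero hr h2
  have hsq : (r / √2) ^ 2 + (r / √2) ^ 2 = r ^ 2 := by rw [div_pow, hs]; ring
  -- Since `‖p‖ = ‖q‖`, the rhombus diagonals `p + q` and `p - q` are orthogonal; they give the
  -- axes.
  rw [← ellipseOf_congr (p := p) (q := q) (w₁ := r / √2) (w₂ := r / √2) (z₁ := r / √2)
    (z₂ := -(r / √2)) hr hsq (by rw [neg_sq, hsq]) (by ring)]
  rw [LinearIndependent.pair_iff] at hli
  apply isEllipse_of_orthogonal
  · intro h; exact hx (hli _ _ h).1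
  · intro h; exact hx (hli _ _ h).1
  · rw [inner_comb, hpq]; ring

lemma isInscribed_minEllipse {P p q : Plane} {β δ : ℝ} {A B C D : Plane}
    (hQ : IsObliqueQuad P p q β δ A B C D) :
    IsInscribed (minEllipse P p q β δ) A B C D := by
  obtain ⟨ξ, η, hf⟩ := exists_isFrame hQ.linearIndependent
  have hβ := hQ.β_pos
  have hδ := hQ.δ_pos
  have hr := minRadius_pos hβ hδ
  have hb : √(β ^ 2 + 1) ^ 2 = β ^ 2 + 1 := Real.sq_sqrt (by positivity)
  have hd : √(δ ^ 2 + 1) ^ 2 = δ ^ 2 + 1 := Real.sq_sqrt (by positivity)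
  have hm := minRadius_mul β δ
  have hB : ∀ ε : ℝ, ε ^ 2 = 1 →
      IsTangentToSide (minEllipse P p q β δ) (P + ε • p) (P + β • q) := fun ε hε =>
    isTangentToSide_ellipseOf hf hε hr.ne' hb (by unfold minCenter; ring) (by positivity)
      (minRadius_mul_div_le hβ hδ)
  have hD : ∀ ε : ℝ, ε ^ 2 = 1 →
      IsTangentToSide (minEllipse P p q β δ) (P + ε • p) (P + (-δ) • q) := fun ε hε => by
    -- The negative root, because the center lies on the other side of these lines relative to the
    -- normal `(ετ, 1)`.
    refine isTangentToSide_ellipseOf (b := -√(δ ^ 2 + 1)) hf hε hr.ne'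
      (by rw [neg_sq, neg_sq, hd]) (by unfold minCenter; linarith) ?_ ?_
    · rw [mul_neg, neg_div_neg_eq]; positivity
    · rw [mul_neg, neg_div_neg_eq, minRadius_comm]; exact minRadius_mul_div_le hδ hβ
  refine ⟨isEllipse_of_norm_eq hr.ne' hQ.norm_eq hQ.linearIndependent, ?_, ?_, ?_, ?_, ?_⟩
  · rintro _ ⟨s, t, h, rfl⟩
    have e : P + minCenter β δ • q + s • minRadius β δ • p + t • minRadius β δ • q =
      P + (minRadius β δ * s) • p + (minCenter β δ + minRadius β δ * t) • q := by module
    rw [e]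
    -- Cauchy-Schwarz for `(|s|, y)` and `(x, 1)`.
    have cs : ∀ x y : ℝ, y ^ 2 = t ^ 2 → |s| * x + y ≤ √(x ^ 2 + 1) := fun x y hy => by
      apply Real.le_sqrt_of_sq_le
      have := sq_abs s
      nlinarith [sq_nonneg (|s| - y * x)]
    have c1 := mul_le_mul_of_nonneg_left (cs β t rfl) hr.le
    have c2 := mul_le_mul_of_nonneg_left (cs δ (-t) (by ring)) hr.le
    apply mem_convexHull_of_abs_le hQ
    · rw [abs_mul, abs_of_pos hr]; unfold minCenter; linarith
    · rw [abs_mul, abs_of_pos hr]; unfold minCenter; linarith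
  · rw [hQ.eqA, hQ.eqB]; exact hB _ (by norm_num)
  · rw [hQ.eqC, hQ.eqB]; exact (hB _ (by norm_num)).symm
  · rw [hQ.eqC, hQ.eqD]; exact hD _ (by norm_num)
  · rw [hQ.eqA, hQ.eqD]; exact (hD _ (by norm_num)).symm

/-! ### Necessary conditions for being inscribed -/

/-- A line supporting the quadrilateral along a side is a supporting line of every inscribed
ellipse. -/
lemma support_eq_of_tangent {S : Set Plane} {c w z U V : Plane}
    (hsub : ellipseOf c w z ⊆ convexHull ℝ S) (ht : IsTangentToSide (ellipseOf c w z) U V)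
    (f : Plane →ₗ[ℝ] ℝ) {d : ℝ} (hS : ∀ X ∈ S, f X ≤ d) (hU : f U = d) (hV : f V = d) :
    f c + √(f w ^ 2 + f z ^ 2) = d := by
  refine (isGreatest_image_ellipseOf f c w z).unique ⟨?_, ?_⟩
  · obtain ⟨T, hT, hE⟩ := ht
    have hTE : T ∈ (line[ℝ, U, V] : Set Plane) ∩ ellipseOf c w z := by rw [hE]; rfl
    refine ⟨T, hTE.2, ?_⟩
    obtain ⟨a, b, _, _, hab, rfl⟩ := hT
    simp only [map_add, map_smul, smul_eq_mul, hU, hV]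
    linear_combination d * hab
  · rintro _ ⟨X, hX, rfl⟩
    exact convexHull_min (t := {X | f X ≤ d}) hS (convex_halfSpace_le f.isLinear d) (hsub hX)

/-- In the oblique coordinates along the diagonals, the center of an inscribed ellipse lies on one
diagonal, its matrix is diagonal, and two scalar conditions remain. -/
lemma inscribed_constraints {P p q : Plane} {β δ : ℝ} {A B C D : Plane} {ξ η : Plane →ₗ[ℝ] ℝ}
    (hf : IsFrame p q ξ η) (hQ : IsObliqueQuad P p q β δ A B C D) {c w z : Plane}
    (h : IsInscribed (ellipseOf c w z) A B C D) :
    ξ (c - P) = 0 ∧ ξ w * η w + ξ z * η z = 0 ∧ 0 ≤ β - η (c - P) ∧ 0 ≤ δ + η (c - P) ∧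
    (β - η (c - P)) ^ 2 = β ^ 2 * (ξ w ^ 2 + ξ z ^ 2) + (η w ^ 2 + η z ^ 2) ∧
    (δ + η (c - P)) ^ 2 = δ ^ 2 * (ξ w ^ 2 + ξ z ^ 2) + (η w ^ 2 + η z ^ 2) := by
  obtain ⟨rfl, rfl, rfl, rfl, hβ, hδ, -, -⟩ := hQ
  -- The functional `x • ξ + y • η`, measured from `P`, is at most `d` at all vertices and equals
  -- `d` on the side, so the support function gives one equation per side.
  have key : ∀ x y d : ℝ, -x ≤ d → x ≤ d → β * y ≤ d → -δ * y ≤ d → ∀ ε τ : ℝ,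
      IsTangentToSide (ellipseOf c w z) (P + ε • p) (P + τ • q) → ε * x = d → τ * y = d →
      0 ≤ d - x * ξ (c - P) - y * η (c - P) ∧ (d - x * ξ (c - P) - y * η (c - P)) ^ 2 =
        (x * ξ w + y * η w) ^ 2 + (x * ξ z + y * η z) ^ 2 := by
    intro x y d h1 h2 h3 h4 ε τ ht h5 h6
    have hs := support_eq_of_tangent h.subset ht (x • ξ + y • η)
      (d := d + x * ξ P + y * η P) ?_ ?_ ?_
    · simp only [LinearMap.add_apply, LinearMap.smul_apply, smul_eq_mul] at hs
      have e : d - x * ξ (c - P) - y * η (c - P) =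
          √((x * ξ w + y * η w) ^ 2 + (x * ξ z + y * η z) ^ 2) := by
        rw [map_sub, map_sub]; linarith
      rw [e]
      exact ⟨Real.sqrt_nonneg _, Real.sq_sqrt (by positivity)⟩
    · simp only [Set.mem_insert_iff, Set.mem_singleton_iff, forall_eq_or_imp, forall_eq,
        LinearMap.add_apply, LinearMap.smul_apply, smul_eq_mul, map_add, map_smul, hf.ξp, hf.ξq,
        hf.ηp, hf.ηq]
      refine ⟨?_, ?_, ?_, ?_⟩ <;> linarith
    all_goals
      simp only [LinearMap.add_apply, LinearMap.smul_apply, smul_eq_mul, map_add, map_smul, hf.ξp,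
        hf.ξq, hf.ηp, hf.ηq]
      linarith
  have hβδ : 0 < β * δ := mul_pos hβ hδ
  obtain ⟨p1, k1⟩ := key (-β) 1 β (by linarith) (by linarith) (by linarith) (by linarith) _ _
    h.tangent_AB (by ring) (by ring)
  obtain ⟨p2, k2⟩ := key β 1 β (by linarith) (by linarith) (by linarith) (by linarith) _ _
    h.tangent_BC.symm (by ring) (by ring)
  obtain ⟨p3, k3⟩ := key δ (-1) δ (by linarith) (by linarith) (by linarith) (by linarith) _ _
    h.tangent_CD (by ring) (by ring)
  obtain ⟨p4, k4⟩ := key (-δ) (-1) δ (by linarith) (by linarith) (by linarith) (by linarith) _ _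
    h.tangent_DA.symm (by ring) (by ring)
  generalize ξ (c - P) = x at *
  generalize η (c - P) = y at *
  -- Differences of mirror-image sides isolate the off-diagonal term; it cancels between `m1'` and
  -- `m2'`, leaving `x * (β + δ) = 0`. The sums give the two final equations.
  have m1 : β * (x * (β - y) + (ξ w * η w + ξ z * η z)) = 0 := by linear_combination (k1 - k2) / 4
  have m2 : δ * (x * (δ + y) - (ξ w * η w + ξ z * η z)) = 0 := by linear_combination (k4 - k3) / 4
  have m1' := (mul_eq_zero.1 m1).resolve_left hβ.ne'
  have m2' := (mul_eq_zero.1 m2).resolve_left hδ.ne'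
  have hx : x = 0 := by
    have : x * (β + δ) = 0 := by linear_combination m1' + m2'
    exact (mul_eq_zero.1 this).resolve_right (by positivity)
  subst hx
  refine ⟨rfl, by linarith, by linarith, by linarith, ?_, ?_⟩
  · linear_combination (k1 + k2) / 2
  · linear_combination (k3 + k4) / 2

/-! ### Axes, eccentricity and minimality -/

lemma gram_pos {p q : Plane} (h : LinearIndependent ℝ ![p, q]) :
    0 < ‖p‖ ^ 2 * ‖q‖ ^ 2 - inner ℝ p q ^ 2 := by
  rw [LinearIndependent.pair_iff] at h
  have hp : 0 < ‖p‖ ^ 2 := by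
    have : p ≠ 0 := by
      rintro rfl
      exact one_ne_zero (h 1 0 (by simp)).1
    positivity
  have hne : inner ℝ p q • p + (-‖p‖ ^ 2) • q ≠ 0 := fun h0 => by
    have := (h _ _ h0).2
    linarith
  have h1 : 0 < ‖inner ℝ p q • p + (-‖p‖ ^ 2) • q‖ ^ 2 := by positivity
  rw [norm_sq_comb] at h1
  refine pos_of_mul_pos_right (a := ‖p‖ ^ 2) ?_ hp.le
  linarith

/-- Sum and product of the squared axes are the trace and determinant of the ellipse's form.
Diagonality kills the `inner ℝ p q` term of the trace and reduces the squared coordinate determinant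
to a product. -/
lemma axes_eq_of_diagonal {p q u v : Plane} {ξ η : Plane →ₗ[ℝ] ℝ} {a b : ℝ}
    (hf : IsFrame p q ξ η) (hpq : ‖p‖ = ‖q‖) (hu : ‖u‖ = 1) (hv : ‖v‖ = 1)
    (huv : inner ℝ u v = 0)
    (h : ξ (a • u) * η (a • u) + ξ (b • v) * η (b • v) = 0) :
    a ^ 2 + b ^ 2 = (ξ (a • u) ^ 2 + ξ (b • v) ^ 2 + (η (a • u) ^ 2 + η (b • v) ^ 2)) * ‖p‖ ^ 2 ∧
    a ^ 2 * b ^ 2 = (ξ (a • u) ^ 2 + ξ (b • v) ^ 2) * (η (a • u) ^ 2 + η (b • v) ^ 2) *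
      (‖p‖ ^ 2 * ‖q‖ ^ 2 - inner ℝ p q ^ 2) := by
  have h1 : ‖a • u‖ ^ 2 = a ^ 2 := by rw [norm_smul, hu, mul_one, Real.norm_eq_abs, sq_abs]
  have h2 : ‖b • v‖ ^ 2 = b ^ 2 := by rw [norm_smul, hv, mul_one, Real.norm_eq_abs, sq_abs]
  have h3 : inner ℝ (a • u) (b • v) = 0 := by
    rw [real_inner_smul_left, real_inner_smul_right, huv]; simp
  generalize a • u = w at *
  generalize b • v = z at *
  rw [← hf.repr w, norm_sq_comb] at h1
  rw [← hf.repr z, norm_sq_comb] at h2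
  rw [← hf.repr w, ← hf.repr z, inner_comb] at h3
  rw [← hpq] at *
  constructor
  · linear_combination -h1 - h2 + 2 * inner ℝ p q * h
  · rw [← h1, ← h2]
    linear_combination (ξ w * ξ z * ‖p‖ ^ 2 + (ξ w * η z + η w * ξ z) * inner ℝ p q +
        η w * η z * ‖p‖ ^ 2) * h3 -
      (ξ w * η w + ξ z * η z) * (‖p‖ ^ 2 * ‖p‖ ^ 2 - inner ℝ p q ^ 2) * h

/-- With capitals for squares, `AB(A' + B')² - A'B'(A + B)² = (BA' - AB')(AA' - BB')`, and the last
factor is nonnegative. It vanishes only for two circles, where `BA' = AB'` as well. -/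
lemma eccentricity_le_iff {a b a' b' : ℝ} (hb : 0 < b) (hab : b ≤ a) (hb' : 0 < b')
    (hab' : b' ≤ a') :
    √(1 - b' ^ 2 / a' ^ 2) ≤ √(1 - b ^ 2 / a ^ 2) ↔
      a ^ 2 * b ^ 2 * (a' ^ 2 + b' ^ 2) ^ 2 ≤ a' ^ 2 * b' ^ 2 * (a ^ 2 + b ^ 2) ^ 2 := by
  have hA : b ^ 2 ≤ a ^ 2 := by gcongr
  have hA' : b' ^ 2 ≤ a' ^ 2 := by gcongr
  have hB : 0 < b ^ 2 := by positivity
  have hB' : 0 < b' ^ 2 := by positivity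
  generalize a ^ 2 = A at *
  generalize b ^ 2 = B at *
  generalize a' ^ 2 = A' at *
  generalize b' ^ 2 = B' at *
  have hA0 := hB.trans_le hA
  have hA0' := hB'.trans_le hA'
  rw [Real.sqrt_le_sqrt_iff (by rw [sub_nonneg, div_le_one hA0]; exact hA), sub_le_sub_iff_left,
    div_le_div_iff₀ hA0 hA0']
  have hle : B * B' ≤ A * A' := mul_le_mul hA hA' hB'.le hA0.le
  constructor
  · intro h
    nlinarith [mul_nonneg (sub_nonneg.2 h) (sub_nonneg.2 hle)]
  · intro h
    by_contra! hlt
    have h1 : 0 < A * A' - B * B' := by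
      rcases hA.lt_or_eq with h2 | rfl
      · nlinarith
      · rcases hA'.lt_or_eq with h2 | rfl
        · nlinarith
        · linarith
    nlinarith [mul_pos (sub_pos.2 hlt) h1]

section
variable {P p q : Plane} {β δ : ℝ} {A B C D : Plane} {ξ η : Plane →ₗ[ℝ] ℝ}

lemma sum_sq_of_minEllipse (hf : IsFrame p q ξ η) {c w z : Plane}
    (h : ellipseOf c w z = minEllipse P p q β δ) :
    ξ w ^ 2 + ξ z ^ 2 = minRadius β δ ^ 2 ∧ η w ^ 2 + η z ^ 2 = minRadius β δ ^ 2 := by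
  have h1 := (ellipseOf_inj_center h ξ).2
  have h2 := (ellipseOf_inj_center h η).2
  simp only [map_smul, hf.ξp, hf.ξq, hf.ηp, hf.ηq, smul_eq_mul] at h1 h2
  exact ⟨by linarith, by linarith⟩

lemma eq_minEllipse_of_sum_sq_eq (hf : IsFrame p q ξ η) (hQ : IsObliqueQuad P p q β δ A B C D)
    {c w z : Plane} (h : IsInscribed (ellipseOf c w z) A B C D)
    (he : ξ w ^ 2 + ξ z ^ 2 = η w ^ 2 + η z ^ 2) :
    ellipseOf c w z = minEllipse P p q β δ := by
  obtain ⟨hx, h12, hy1, hy2, e1, e2⟩ := inscribed_constraints hf hQ h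
  have hm : 0 ≤ ξ w ^ 2 + ξ z ^ 2 := by positivity
  -- With `m = n` the constraints become linear in `√m`; adding `g1` and `g2` eliminates the center
  -- and yields `minRadius`.
  have g1 : β - η (c - P) = √(ξ w ^ 2 + ξ z ^ 2) * √(β ^ 2 + 1) := by
    rw [← Real.sqrt_mul hm, ← Real.sqrt_sq hy1, e1, ← he]
    congr 1; ring
  have g2 : δ + η (c - P) = √(ξ w ^ 2 + ξ z ^ 2) * √(δ ^ 2 + 1) := by
    rw [← Real.sqrt_mul hm, ← Real.sqrt_sq hy2, e2, ← he]
    congr 1; ring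
  have hr : √(ξ w ^ 2 + ξ z ^ 2) = minRadius β δ := by
    unfold minRadius
    rw [eq_div_iff (by positivity)]
    linarith
  have hr2 : ξ w ^ 2 + ξ z ^ 2 = minRadius β δ ^ 2 := by rw [← hr, Real.sq_sqrt hm]
  have hc : c = P + minCenter β δ • q := by
    have : η (c - P) = minCenter β δ := by
      unfold minCenter; rw [hr] at g1; linarith
    have h3 := hf.repr (c - P)
    rw [hx, this, zero_smul, zero_add] at h3
    rw [h3]; abel
  unfold minEllipse
  rw [← ellipseOf_congr (minRadius_pos hQ.β_pos hQ.δ_pos).ne' hr2 (he ▸ hr2) h12, hf.repr,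
    hf.repr, hc]

lemma axes_of_inscribed (hf : IsFrame p q ξ η) (hQ : IsObliqueQuad P p q β δ A B C D)
    {E : Set Plane} {c u v : Plane} {a b : ℝ} (hE : IsEllipseWith E c u v a b)
    (h : IsInscribed E A B C D) :
    a ^ 2 + b ^ 2 = (ξ (a • u) ^ 2 + ξ (b • v) ^ 2 + (η (a • u) ^ 2 + η (b • v) ^ 2)) * ‖p‖ ^ 2 ∧
    a ^ 2 * b ^ 2 = (ξ (a • u) ^ 2 + ξ (b • v) ^ 2) * (η (a • u) ^ 2 + η (b • v) ^ 2) *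
      (‖p‖ ^ 2 * ‖q‖ ^ 2 - inner ℝ p q ^ 2) := by
  rw [hE.eq_ellipseOf] at h
  exact axes_eq_of_diagonal hf hQ.norm_eq hE.norm_u hE.norm_v hE.inner_uv
    (inscribed_constraints hf hQ h).2.1

lemma eccentricity_minEllipse_le (hQ : IsObliqueQuad P p q β δ A B C D) {E : Set Plane}
    {c u v c' u' v' : Plane} {a b a' b' : ℝ} (hE : IsEllipseWith E c u v a b)
    (h : IsInscribed E A B C D)
    (hM : IsEllipseWith (minEllipse P p q β δ) c' u' v' a' b') :
    √(1 - b' ^ 2 / a' ^ 2) ≤ √(1 - b ^ 2 / a ^ 2) ∧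
      (√(1 - b ^ 2 / a ^ 2) ≤ √(1 - b' ^ 2 / a' ^ 2) → E = minEllipse P p q β δ) := by
  obtain ⟨ξ, η, hf⟩ := exists_isFrame hQ.linearIndependent
  obtain ⟨s1, s2⟩ := axes_of_inscribed hf hQ hE h
  obtain ⟨t1, t2⟩ := axes_of_inscribed hf hQ hM (isInscribed_minEllipse hQ)
  obtain ⟨r1, r2⟩ := sum_sq_of_minEllipse hf hM.eq_ellipseOf.symm
  have hr : 0 < minRadius β δ ^ 2 := pow_pos (minRadius_pos hQ.β_pos hQ.δ_pos) 2
  rw [r1, r2] at t1 t2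
  have hg := gram_pos hQ.linearIndependent
  have hN : 0 < (‖p‖ ^ 2) ^ 2 := by
    have : p ≠ 0 := by simpa using hQ.linearIndependent.ne_zero 0
    positivity
  rw [eccentricity_le_iff hE.b_pos hE.b_le_a hM.b_pos hM.b_le_a,
    eccentricity_le_iff hM.b_pos hM.b_le_a hE.b_pos hE.b_le_a, s1, s2, t1, t2]
  have hE' := h
  rw [hE.eq_ellipseOf] at hE'
  have huniq := eq_minEllipse_of_sum_sq_eq hf hQ hE'
  rw [← hE.eq_ellipseOf] at huniq
  generalize ξ (a • u) ^ 2 + ξ (b • v) ^ 2 = m at *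
  generalize η (a • u) ^ 2 + η (b • v) ^ 2 = n at *
  generalize ‖p‖ ^ 2 * ‖q‖ ^ 2 - inner ℝ p q ^ 2 = g at *
  generalize minRadius β δ ^ 2 = r at *
  -- The two sides of the comparison differ by this factor times `(m + n)² - 4mn = (m - n)²`.
  have hK : 0 < r ^ 2 * g * (‖p‖ ^ 2) ^ 2 := by positivity
  constructor
  · nlinarith [mul_nonneg hK.le (sq_nonneg (m - n))]
  · intro hle
    apply huniq
    have h0 : r ^ 2 * g * (‖p‖ ^ 2) ^ 2 * (m - n) ^ 2 ≤ 0 := by nlinarith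
    have h1 : (m - n) ^ 2 ≤ 0 := by
      by_contra! hc
      exact absurd (mul_pos hK hc) (not_lt.2 h0)
    nlinarith [pow_eq_zero_iff (two_ne_zero) |>.1 (le_antisymm h1 (sq_nonneg _))]

lemma isMinEccentricityInscribed_iff (hQ : IsObliqueQuad P p q β δ A B C D) (E : Set Plane) :
    IsMinEccentricityInscribed E A B C D ↔ E = minEllipse P p q β δ := by
  have hI := isInscribed_minEllipse hQ
  obtain ⟨c', u', v', a', b', hM⟩ := hI.isEllipse
  constructor
  · rintro ⟨h, e, ⟨c, u, v, a, b, hE, rfl⟩, hmin⟩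
    exact (eccentricity_minEllipse_le hQ hE h hM).2
      (hmin _ _ hI ⟨c', u', v', a', b', hM, rfl⟩)
  · rintro rfl
    refine ⟨hI, _, ⟨c', u', v', a', b', hM, rfl⟩, ?_⟩
    rintro E' _ h ⟨c, u, v, a, b, hE, rfl⟩
    exact (eccentricity_minEllipse_le hQ hE h hM).1

end

/-! ### Centers and conjugate diameters -/

lemma IsCenterOf.eq {c w z c' : Plane} (h : IsCenterOf (ellipseOf c w z) c') : c' = c := by
  obtain ⟨u, v, a, b, hE⟩ := h
  have h0 := hE.eq_ellipseOf
  have := (ellipseOf_inj_center h0 (innerₗ Plane (c' - c))).1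
  simp only [innerₗ_apply_apply] at this
  have h1 : inner ℝ (c' - c) (c' - c) = 0 := by
    rw [inner_sub_right, this, sub_self]
  exact sub_eq_zero.1 (inner_self_eq_zero.1 h1)

lemma isCenterOf_ellipseOf {c w z : Plane} (h : IsEllipse (ellipseOf c w z)) :
    IsCenterOf (ellipseOf c w z) c := by
  obtain ⟨c', h'⟩ := h
  have h'' : IsCenterOf (ellipseOf c w z) c' := h'
  rwa [h''.eq] at h''

lemma bisectsChordsParallelTo_ellipseOf {c w z : Plane} (hli : LinearIndependent ℝ ![w, z]) :
    BisectsChordsParallelTo (ellipseOf c w z) (c + w) (c - w) (c + z) (c - z) := by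
  obtain ⟨ξ, η, hf⟩ := exists_isFrame hli
  rintro _ ⟨s, t, h, rfl⟩ _ ⟨s', t', h', rfl⟩ hne ⟨l, hl⟩
  have g := congrArg ξ hl
  simp only [map_add, map_sub, map_smul, smul_eq_mul, hf.ξp, hf.ξq] at g
  have hs : s' = s := by linarith
  subst hs
  have ht : t' = -t := by
    have : (t' - t) * (t' + t) = 0 := by linear_combination h' - h
    rcases mul_eq_zero.1 this with h1 | h1
    · exact absurd (by rw [sub_eq_zero.1 h1]) hne
    · linarith
  subst ht
  refine ⟨(1 + s') / 2, (1 - s') / 2, ?_, ?_, by ring, ?_⟩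
  · nlinarith [sq_nonneg t]
  · nlinarith [sq_nonneg t]
  · rw [midpoint_eq_smul_add, invOf_eq_inv]
    module

lemma areEqualConjugateDiameters_ellipseOf {c w z : Plane} (hli : LinearIndependent ℝ ![w, z])
    (hE : IsEllipse (ellipseOf c w z)) (hwz : ‖w‖ = ‖z‖) :
    AreEqualConjugateDiameters (ellipseOf c w z) (c + w) (c - w) (c + z) (c - z) := by
  have hm : ∀ x : Plane, midpoint ℝ (c + x) (c - x) = c := fun x => by
    rw [midpoint_eq_smul_add, invOf_eq_inv]; module
  have hd : ∀ x : Plane, dist (c + x) (c - x) = 2 * ‖x‖ := fun x => by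
    rw [dist_eq_norm, show c + x - (c - x) = (2 : ℝ) • x by module, norm_smul]; simp
  have hc := isCenterOf_ellipseOf hE
  refine ⟨⟨⟨1, 0, by norm_num, by simp⟩, ⟨-1, 0, by norm_num, by simp [sub_eq_add_neg]⟩,
      by rwa [hm]⟩, ⟨⟨0, 1, by norm_num, by simp⟩, ⟨0, -1, by norm_num, by simp [sub_eq_add_neg]⟩,
      by rwa [hm]⟩, bisectsChordsParallelTo_ellipseOf hli, ?_, by rw [hd, hd, hwz]⟩
  rw [ellipseOf_swap]
  exact bisectsChordsParallelTo_ellipseOf (LinearIndependent.pair_symm_iff.1 hli)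

lemma IsDiameter.exists_coords {c w z P P' : Plane} (h : IsDiameter (ellipseOf c w z) P P') :
    ∃ x y : ℝ, x ^ 2 + y ^ 2 = 1 ∧ P = c + (x • w + y • z) ∧ P' = c - (x • w + y • z) := by
  obtain ⟨⟨x, y, hxy, hP⟩, -, hc⟩ := h
  refine ⟨x, y, hxy, by rw [hP, add_assoc], ?_⟩
  have h1 : P + P' = (2 : ℝ) • c := by
    rw [← hc.eq, midpoint_eq_smul_add, invOf_eq_inv, smul_inv_smul₀ two_ne_zero]
  have h2 : P' = (2 : ℝ) • c - P := by rw [← h1]; abel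
  rw [h2, hP]
  module

/-- Conjugate diameters of an ellipse come from a rotation of its parameter circle. -/
lemma conjugate_coords {c w z : Plane} (hli : LinearIndependent ℝ ![w, z]) {x y x' y' : ℝ}
    (h : x ^ 2 + y ^ 2 = 1) (h' : x' ^ 2 + y' ^ 2 = 1)
    (hb : BisectsChordsParallelTo (ellipseOf c w z) (c + (x • w + y • z)) (c - (x • w + y • z))
      (c + (x' • w + y' • z)) (c - (x' • w + y' • z))) :
    x = -y' ∧ y = x' ∨ x = y' ∧ y = -x' := by
  obtain ⟨ξ, η, hf⟩ := exists_isFrame hli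
  -- A test chord in direction `(x', y')`; the 3-4-5 triple puts its ends on the unit circle and its
  -- midpoint off the center, so the midpoint fixes the line of `(x, y)`.
  have hX : ∀ e : ℝ, e ^ 2 = 1 → c + ((3 / 5) * -y' + e * (4 / 5) * x') • w +
      ((3 / 5) * x' + e * (4 / 5) * y') • z ∈ ellipseOf c w z := fun e he =>
    ⟨_, _, by linear_combination (9 / 25 + e ^ 2 * (16 / 25)) * h' + 16 / 25 * he, rfl⟩
  have hne : c + ((3 / 5) * -y' + 1 * (4 / 5) * x') • w + ((3 / 5) * x' + 1 * (4 / 5) * y') • z ≠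
      c + ((3 / 5) * -y' + -1 * (4 / 5) * x') • w + ((3 / 5) * x' + -1 * (4 / 5) * y') • z := by
    intro he
    have g1 := congrArg ξ he
    have g2 := congrArg η he
    simp only [map_add, map_smul, smul_eq_mul, hf.ξp, hf.ξq, hf.ηp, hf.ηq] at g1 g2
    have : x' = 0 := by linarith
    have : y' = 0 := by linarith
    simp_all
  obtain ⟨s, t, -, -, hst, hm⟩ := hb _ (hX 1 (by norm_num)) _ (hX (-1) (by norm_num)) hne
    ⟨4 / 5, by module⟩
  rw [midpoint_eq_smul_add, invOf_eq_inv] at hm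
  have g1 := congrArg ξ hm
  have g2 := congrArg η hm
  simp only [map_add, map_sub, map_smul, smul_eq_mul, hf.ξp, hf.ξq, hf.ηp, hf.ηq] at g1 g2
  have k1 : (s - t) * x = -(3 / 5) * y' := by linear_combination g1 - ξ c * hst
  have k2 : (s - t) * y = 3 / 5 * x' := by linear_combination g2 - η c * hst
  have k3 : (s - t - 3 / 5) * (s - t + 3 / 5) = 0 := by
    linear_combination ((s - t) * x - (3 / 5) * y') * k1 + ((s - t) * y + 3 / 5 * x') * k2
      - (s - t) ^ 2 * h + 9 / 25 * h'
  rcases mul_eq_zero.1 k3 with k | k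
  · have : s - t = 3 / 5 := by linarith
    rw [this] at k1 k2
    left; constructor <;> linarith
  · have : s - t = -(3 / 5) := by linarith
    rw [this] at k1 k2
    right; constructor <;> linarith

/-! ### Angles between equal conjugate diameters -/

lemma smallestAngle_comm (P P' R R' : Plane) :
    smallestAngle P P' R R' = smallestAngle R R' P P' := by
  simp [smallestAngle, InnerProductGeometry.angle_comm]

lemma smallestAngle_eq_arccos (P P' R R' : Plane) :
    smallestAngle P P' R R' =
      Real.arccos (|inner ℝ (P' - P) (R' - R)| / (‖P' - P‖ * ‖R' - R‖)) := by
  have hpos : 0 ≤ ‖P' - P‖ * ‖R' - R‖ := by positivity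
  unfold smallestAngle InnerProductGeometry.angle
  rw [← Real.arccos_neg, ← neg_div]
  rcases le_total 0 (inner ℝ (P' - P) (R' - R)) with h | h
  · rw [abs_of_nonneg h]
    exact min_eq_left (Real.antitone_arccos (by gcongr; linarith))
  · rw [abs_of_nonpos h]
    exact min_eq_right (Real.antitone_arccos (by gcongr; linarith))

lemma smallestAngle_of_smul {P P' R R' p q : Plane} {x y : ℝ} (hx : x ≠ 0) (hy : y ≠ 0)
    (hP : P' - P = x • p) (hR : R' - R = y • q) :
    smallestAngle P P' R R' = Real.arccos (|inner ℝ p q| / (‖p‖ * ‖q‖)) := by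
  rw [smallestAngle_eq_arccos, hP, hR, real_inner_smul_left, real_inner_smul_right, abs_mul,
    abs_mul, norm_smul, norm_smul, Real.norm_eq_abs, Real.norm_eq_abs]
  have := abs_pos.2 hx
  have := abs_pos.2 hy
  congr 1
  rw [← mul_assoc, show |x| * ‖p‖ * (|y| * ‖q‖) = (|x| * |y|) * (‖p‖ * ‖q‖) by ring,
    mul_div_mul_left _ _ (by positivity)]

lemma smallestAngle_equalConjugate {c p q : Plane} (hli : LinearIndependent ℝ ![p, q])
    (hpq : ‖p‖ = ‖q‖) {P P' R R' : Plane}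
    (h : AreEqualConjugateDiameters (ellipseOf c p q) P P' R R') :
    smallestAngle P P' R R' = Real.arccos (|inner ℝ p q| / (‖p‖ * ‖q‖)) := by
  obtain ⟨x, y, hxy, rfl, rfl⟩ := h.diameter_left.exists_coords
  obtain ⟨x', y', hxy', rfl, rfl⟩ := h.diameter_right.exists_coords
  have hconj := conjugate_coords hli hxy hxy' h.bisects_left
  have hsub : ∀ v : Plane, c - v - (c + v) = (-2 : ℝ) • v := fun v => by module
  have heq := h.equal
  rw [dist_comm, dist_comm (c + _), dist_eq_norm, dist_eq_norm, hsub, hsub, norm_smul,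
    norm_smul] at heq
  have heq' := congrArg (· ^ 2) (mul_left_cancel₀ (by norm_num) heq)
  simp only [norm_sq_comb] at heq'
  -- Conjugacy gives `xy = -x'y'`, while equal length with `‖p‖ = ‖q‖` makes the cross terms agree.
  -- So the diameters lie along `p` and `q`, or `p ⟂ q`.
  have hzero : x' * y' * inner ℝ p q = 0 := by
    rw [← hpq] at heq'
    rcases hconj with ⟨rfl, rfl⟩ | ⟨rfl, rfl⟩ <;> linear_combination (-1 / 4) * heq'
  rcases mul_eq_zero.1 hzero with h0 | h0
  · rcases mul_eq_zero.1 h0 with rfl | rfl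
    · have hy' : y' ≠ 0 := by rintro rfl; norm_num at hxy'
      have hy : y = 0 := by rcases hconj with h | h <;> simpa using h.2
      subst hy
      have hx : x ≠ 0 := by rintro rfl; norm_num at hxy
      exact smallestAngle_of_smul (x := -2 * x) (y := -2 * y') (by simpa) (by simpa)
        (by rw [hsub]; module) (by rw [hsub]; module)
    · have hx' : x' ≠ 0 := by rintro rfl; norm_num at hxy'
      have hx : x = 0 := by rcases hconj with h | h <;> simpa using h.1
      subst hx
      have hy : y ≠ 0 := by rintro rfl; norm_num at hxy
      rw [smallestAngle_comm]
      exact smallestAngle_of_smul (x := -2 * x') (y := -2 * y) (by simpa) (by simpa)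
        (by rw [hsub]; module) (by rw [hsub]; module)
  · rw [smallestAngle_eq_arccos, hsub, hsub, real_inner_smul_left, real_inner_smul_right,
      inner_comb, h0, ← hpq]
    rcases hconj with ⟨rfl, rfl⟩ | ⟨rfl, rfl⟩ <;> congr 1 <;> ring_nf <;> simp

/-! ### Reduction to oblique coordinates -/

/-- The assertion about a quadrilateral made by the main theorem. -/
def UniqueMinWithDiagonalAngle (A B C D : Plane) : Prop :=
  (∃! E : Set Plane, IsMinEccentricityInscribed E A B C D) ∧
    ∀ E : Set Plane, IsMinEccentricityInscribed E A B C D →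
      (∃ P P' R R' : Plane, AreEqualConjugateDiameters E P P' R R') ∧
      ∀ P P' R R' : Plane, AreEqualConjugateDiameters E P P' R R' →
        smallestAngle P P' R R' = smallestAngle A C B D

lemma IsObliqueQuad.uniqueMinWithDiagonalAngle {P p q : Plane} {β δ : ℝ} {A B C D : Plane}
    (hQ : IsObliqueQuad P p q β δ A B C D) : UniqueMinWithDiagonalAngle A B C D := by
  have hiff := isMinEccentricityInscribed_iff hQ
  have hr := minRadius_pos hQ.β_pos hQ.δ_pos
  have hli : LinearIndependent ℝ ![minRadius β δ • p, minRadius β δ • q] := by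
    have := hQ.linearIndependent
    rw [LinearIndependent.pair_iff] at this ⊢
    intro s t h
    simpa [hr.ne'] using this (s * minRadius β δ) (t * minRadius β δ)
      (by rw [← h, smul_smul, smul_smul])
  have hn : ‖minRadius β δ • p‖ = ‖minRadius β δ • q‖ := by
    rw [norm_smul, norm_smul, hQ.norm_eq]
  refine ⟨⟨_, (hiff _).2 rfl, fun E h => (hiff E).1 h⟩, fun E h => ?_⟩
  obtain rfl := (hiff E).1 h
  refine ⟨⟨_, _, _, _, areEqualConjugateDiameters_ellipseOf hli h.1.isEllipse hn⟩, ?_⟩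
  intro P₁ P₂ R₁ R₂ hc
  rw [smallestAngle_equalConjugate hli hn hc]
  have hβδ : -(β + δ) ≠ 0 := by linarith [hQ.β_pos, hQ.δ_pos]
  refine (smallestAngle_of_smul (x := 2 / minRadius β δ) (y := -(β + δ) / minRadius β δ)
    (by positivity) (div_ne_zero hβδ hr.ne') ?_ ?_).symm
  · rw [hQ.eqA, hQ.eqC, smul_smul, div_mul_cancel₀ _ hr.ne']; module
  · rw [hQ.eqB, hQ.eqD, smul_smul, div_mul_cancel₀ _ hr.ne']; module

lemma exists_isObliqueQuad {A B C D : Plane} (h : IsConvexQuadrilateral A B C D)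
    (hP : midpoint ℝ A C ∈ segment ℝ B D) :
    ∃ P p q β δ, IsObliqueQuad P p q β δ A B C D := by
  have hAC : A ≠ C := by
    rintro rfl
    exact h.not_collinear_ABC (by simpa [Set.pair_comm] using collinear_pair ℝ A B)
  obtain ⟨s, t, hs, ht, hst, hPe⟩ := hP
  have hcol : ∀ X : Plane, ∀ l : ℝ, X = midpoint ℝ A C + l • (C - A) → Collinear ℝ {A, X, C} := by
    intro X l hX
    rw [collinear_iff_of_mem (p₀ := A) (by simp)]
    refine ⟨C - A, ?_⟩
    simp only [Set.mem_insert_iff, Set.mem_singleton_iff, forall_eq_or_imp, forall_eq,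
      vadd_eq_add]
    refine ⟨⟨0, by simp⟩, ⟨l + 1 / 2, ?_⟩, ⟨1, by simp⟩⟩
    rw [hX, midpoint_eq_smul_add, invOf_eq_inv]
    module
  have hcolB : ¬ ∃ l : ℝ, B = midpoint ℝ A C + l • (C - A) := fun ⟨l, hl⟩ =>
    h.not_collinear_ABC (hcol B l hl)
  have hcolD : ¬ ∃ l : ℝ, D = midpoint ℝ A C + l • (C - A) := fun ⟨l, hl⟩ => by
    apply h.not_collinear_CDA
    have := hcol D l hl
    rwa [show ({C, D, A} : Set Plane) = {A, D, C} by ext; simp; tauto]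
  have hs0 : s ≠ 0 := by
    rintro rfl
    obtain rfl : t = 1 := by linarith
    exact hcolD ⟨0, by rw [← hPe]; simp⟩
  have ht0 : t ≠ 0 := by
    rintro rfl
    obtain rfl : s = 1 := by linarith
    exact hcolB ⟨0, by rw [← hPe]; simp⟩
  have hs' := lt_of_le_of_ne hs hs0.symm
  have ht' := lt_of_le_of_ne ht ht0.symm
  obtain rfl : s = 1 - t := by linarith
  have hBD : B - D ≠ 0 := fun h0 => by
    refine hcolB ⟨0, ?_⟩
    rw [← hPe, sub_eq_zero.1 h0]
    module
  have hn : 0 < ‖B - D‖ := norm_pos_iff.2 hBD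
  have hp : 0 < ‖C - midpoint ℝ A C‖ := by
    rw [norm_pos_iff, sub_ne_zero]
    intro h0
    apply hAC
    rw [eq_comm, midpoint_eq_right_iff] at h0
    exact h0
  have hpe : C - midpoint ℝ A C = (1 / 2 : ℝ) • (C - A) := by
    rw [midpoint_eq_smul_add, invOf_eq_inv]; module
  -- The scale making `k • (B - D)` as long as half of `AC`.
  set k := ‖C - midpoint ℝ A C‖ / ‖B - D‖ with hk
  have hk0 : 0 < k := div_pos hp hn
  have hB : B = midpoint ℝ A C + (t / k) • k • (B - D) := by
    rw [smul_smul, div_mul_cancel₀ _ hk0.ne', ← hPe]; module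
  refine ⟨midpoint ℝ A C, C - midpoint ℝ A C, k • (B - D), t / k, (1 - t) / k, ?_, hB, ?_, ?_,
    by positivity, by positivity, ?_, ?_⟩
  · rw [midpoint_eq_smul_add, invOf_eq_inv]; module
  · module
  · rw [smul_smul, neg_mul, div_mul_cancel₀ _ hk0.ne', ← hPe]; module
  · rw [norm_smul, Real.norm_eq_abs, abs_of_pos hk0, hk, div_mul_cancel₀ _ hn.ne']
  · rw [LinearIndependent.pair_iff]
    intro x y hxy
    have hy : y = 0 := by
      by_contra hy
      have : k • (B - D) = (-x / y) • (C - midpoint ℝ A C) := by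
        apply smul_right_injective Plane hy
        simp only
        rw [smul_smul y (-x / y), mul_div_cancel₀ _ hy, neg_smul]
        exact eq_neg_of_add_eq_zero_right hxy
      rw [this, hpe, smul_smul, smul_smul] at hB
      exact hcolB ⟨_, hB⟩
    subst hy
    rw [zero_smul, add_zero, smul_eq_zero] at hxy
    exact ⟨hxy.resolve_right (norm_pos_iff.1 hp), rfl⟩

lemma IsConvexQuadrilateral.rotate {A B C D : Plane} (h : IsConvexQuadrilateral A B C D) :
    IsConvexQuadrilateral B C D A :=
  ⟨h.2, h.3, h.4, h.1, by
    rw [Set.inter_comm, segment_symm ℝ C A]; exact h.5⟩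

lemma rotate_set (A B C D : Plane) : ({B, C, D, A} : Set Plane) = {A, B, C, D} := by
  ext; simp; tauto

lemma isInscribed_rotate {E : Set Plane} {A B C D : Plane} :
    IsInscribed E B C D A ↔ IsInscribed E A B C D :=
  ⟨fun h => ⟨h.1, rotate_set A B C D ▸ h.2, h.6, h.3, h.4, h.5⟩,
    fun h => ⟨h.1, (rotate_set A B C D).symm ▸ h.2, h.4, h.5, h.6, h.3⟩⟩

lemma smallestAngle_swap_right (P P' R R' : Plane) :
    smallestAngle P P' R' R = smallestAngle P P' R R' := by
  rw [smallestAngle_eq_arccos, smallestAngle_eq_arccos, ← neg_sub R' R, inner_neg_right, abs_neg,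
    norm_neg]

lemma UniqueMinWithDiagonalAngle.of_rotate {A B C D : Plane}
    (h : UniqueMinWithDiagonalAngle B C D A) : UniqueMinWithDiagonalAngle A B C D := by
  unfold UniqueMinWithDiagonalAngle IsMinEccentricityInscribed at *
  rw [smallestAngle_comm B D, smallestAngle_comm C A, smallestAngle_swap_right,
    smallestAngle_comm B D] at h
  simpa only [isInscribed_rotate] using h

end MidpointDiagonal

theorem theorem1 (A B C D : MidpointDiagonal.Plane)
    (hQ : MidpointDiagonal.IsMidpointDiagonal A B C D) :
    (∃! E : Set MidpointDiagonal.Plane,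
      MidpointDiagonal.IsMinEccentricityInscribed E A B C D) ∧
    ∀ E : Set MidpointDiagonal.Plane,
      MidpointDiagonal.IsMinEccentricityInscribed E A B C D →
      (∃ P P' R R' : MidpointDiagonal.Plane,
        MidpointDiagonal.AreEqualConjugateDiameters E P P' R R') ∧
      ∀ P P' R R' : MidpointDiagonal.Plane,
        MidpointDiagonal.AreEqualConjugateDiameters E P P' R R' →
        MidpointDiagonal.smallestAngle P P' R R' = MidpointDiagonal.smallestAngle A C B D := by
  obtain ⟨hconv, P, ⟨hAC, hBD⟩, rfl | rfl⟩ := hQ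
  · obtain ⟨_, _, _, _, _, h⟩ := MidpointDiagonal.exists_isObliqueQuad hconv hBD
    exact h.uniqueMinWithDiagonalAngle
  -- When `BD` is the bisected diagonal, a cyclic relabeling of the vertices reduces to the previous
  -- case.
  · obtain ⟨_, _, _, _, _, h⟩ := MidpointDiagonal.exists_isObliqueQuad hconv.rotate
      (segment_symm ℝ A C ▸ hAC)
    exact h.uniqueMinWithDiagonalAngle.of_rotate
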